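/- Let $m\ge 1$ and let $G=I_2(m)$ be the dihedral group of order $2m$ acting on $E=\mathbb{R}^2$, with orthonormal basis $\xi,\eta$ and dual basis $x,y$ of $E^*$, generated by the reflections $s_j$ in the roots $\alpha_j=\sin(\pi j/m)\,\xi-\cos(\pi j/m)\,\eta$, $1\le j\le m$; put $a_j=\sin(\pi j/m)\,x-\cos(\pi j/m)\,y\in E^*$. Let $c$ be a complex-valued function on the reflections of $G$ that is constant on conjugacy classes, $c_j=c(s_j)$, and let $H_c=H_c(G,E)$ be the rational Cherednik algebra, i.e. the quotient of $T(E_{\mathbb C}\oplus E_{\mathbb C}^*)\rtimes\mathbb{C}[G]$ by $[v,w]=0$ for $v,w\in E_{\mathbb C}$, $[u,u']=0$ for $u,u'\in E_{\mathbb C}^*$, and $$[v,u]=\langle u,v\rangle-2\sum_{j=1}^m\frac{\langle u,\alpha_j\rangle\langle a_j,v\rangle}{\langle a_j,\alpha_j\rangle}\,c_j\,s_j\qquad(v\in E_{\mathbb C},\ u\in E_{\mathbb C}^*).$$ Put $z=x+iy$, $\bar z=x-iy$, $\zeta=\frac12(\xi-i\eta)$, $\bar\zeta=\frac12(\xi+i\eta)$,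 $\sigma=\sum_{j=1}^m c_js_j$, $H=z\zeta+\bar z\bar\zeta+1-\sigma$ and $Z_0=\bar z\bar\zeta-z\zeta$ in $H_c$. Let $\mathcal{C}$ be the complex Clifford algebra with generators $e_1,e_2$ (corresponding to $\xi,\eta$, and also to $x,y$) satisfying $e_je_k+e_ke_j=2\delta_{jk}$. Put $f=\frac12(e_1-ie_2)$, $f^\dagger=\frac12(e_1+ie_2)$, and let $\mathbb{S}=\mathcal{C}ff^\dagger=\mathbb{S}^0\oplus\mathbb{S}^1$ be the spinor space, with $\mathbb{S}^l$ spanned by $(f^\dagger)^lff^\dagger$. In $H_c\otimes\mathcal{C}$ define $F_-=2\zeta\otimes f^\dagger$, $\bar F_-=2\bar\zeta\otimes f$, $$Z_1=Z_0\otimes 1-\sum_{j=1}^m c_j\,s_j\otimes\Bigl(1-\tfrac{2}{\langle a_j,\alpha_j\rangle}\,\pi^-(\alpha_j)\,\pi^+(a_j)\Bigr),\qquad Z_2=\tfrac12[f^\dagger,f],\qquad Z=2Z_2-Z_1,$$ where $\pi^+$ and $\pi^-$ are the linear projections of $\mathbb{C}e_1\oplus\mathbb{C}e_2$ onto $\mathbb{C}f$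 and $\mathbb{C}f^\dagger$ along the decomposition $\mathbb{C}f\oplus\mathbb{C}f^\dagger$. Let $\tau$ be an irreducible complex representation of $G$ on $V(\tau)$, and let $M_c(\tau)=\mathbb{C}[E]\otimes V(\tau)$ be the standard module of $H_c$, i.e. the module induced from $V(\tau)$, where $G$ acts by $\tau$ and $E$ acts by $0$; let $M_c(\tau)_k$ be its part of polynomial degree $k$. The algebra $H_c\otimes\mathcal{C}$ acts on $K_c(\tau)=M_c(\tau)\otimes\mathbb{S}$. For $k\in\mathbb{Z}_{\ge0}$ and $l\in\{0,1\}$ let $\mathcal{M}_c(\tau)_k^l$ be the subspace of those elements of $M_c(\tau)_k\otimes\mathbb{S}^l$ that are killed by both $F_-$ and $\bar F_-$. Then the element $\sigma$ acts on $V(\tau)$ by a scalar $N_c(\tau)$, and for all $k\in\mathbb{Z}_{\ge 0}$, $l\in\{0,1\}$ and all $M\in\mathcal{M}_c(\tau)_k^l$ $$HM=(k+1-N_c(\tau))M,\qquad Z_2M=(-1)^{l+1}\tfrac12\,M,$$ $$Z_1M=(-1)^l(k-N_c(\tau))M,\qquad ZM=(-1)^{l+1}(k+1-N_c(\tau))M.$$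 In particular the $Z_1$-weight is determined by the other two weights: if $0\ne M\in\mathcal{M}_c(\tau)_k^l$ and $HM=\lambda M$, $Z_2M=\gamma M$, $Z_1M=\nu M$ with $\lambda,\gamma,\nu\in\mathbb{C}$, then $\nu=-2\gamma(\lambda-1)$. -/

import Mathlib

open scoped TensorProduct

noncomputable section

namespace DihedralSpinor

/-! ### The plane `E = ℝ²`, its complexification, and the dihedral group `I₂(m)` -/

/-- The complexification `E_ℂ = ℂ²` of `E = ℝ²`. -/
abbrev EC : Type := Fin 2 → ℂ

/-- The complexified dual space `E_ℂ^*`. -/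
abbrev ECd : Type := Module.Dual ℂ EC

/-- The first vector of the orthonormal basis `{ξ, η}` of `E`. -/
def xi : EC := Pi.single 0 1

/-- The second vector of the orthonormal basis `{ξ, η}` of `E`. -/
def eta : EC := Pi.single 1 1

/-- The first vector of the dual basis `{x, y}` of `E^*`. -/
def xCoord : ECd := LinearMap.proj 0

/-- The second vector of the dual basis `{x, y}` of `E^*`. -/
def yCoord : ECd := LinearMap.proj 1

/-- The matrix, with respect to `ξ, η`, by which an element of the dihedral group of order `2 m`
acts on `E`. With `ω = exp (2 π i / m)` and `E` identified with `ℂ` through `ξ ↦ 1`, `η ↦ i`, the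
rotation `r j` is `v ↦ ω⁻ʲ v` and the reflection `sr j` is `v ↦ ωʲ v̄`. -/
def dihMatrix (m : ℕ) [NeZero m] : DihedralGroup m → Matrix (Fin 2) (Fin 2) ℝ
  | .r j => !![(ZMod.stdAddChar j).re, (ZMod.stdAddChar j).im;
               -(ZMod.stdAddChar j).im, (ZMod.stdAddChar j).re]
  | .sr j => !![(ZMod.stdAddChar j).re, (ZMod.stdAddChar j).im;
                (ZMod.stdAddChar j).im, -(ZMod.stdAddChar j).re]

/-- The action of the dihedral group on `E_ℂ`. -/
def act (m : ℕ) [NeZero m] (g : DihedralGroup m) : EC →ₗ[ℂ] EC :=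
  Matrix.toLin' ((dihMatrix m g).map (fun t : ℝ => (t : ℂ)))

/-- The contragredient action of the dihedral group on `E_ℂ^*`. -/
def actDual (m : ℕ) [NeZero m] (g : DihedralGroup m) (x : ECd) : ECd := x ∘ₗ act m g⁻¹

/-- The roots `α_j = sin (π j / m) ξ - cos (π j / m) η`; the positive ones are those with
`1 ≤ j ≤ m`. -/
def root (m j : ℕ) : EC :=
  (Real.sin (Real.pi * j / m) : ℂ) • xi - (Real.cos (Real.pi * j / m) : ℂ) • eta

/-- The coroots `a_j = sin (π j / m) x - cos (π j / m) y`. -/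
def coroot (m j : ℕ) : ECd :=
  (Real.sin (Real.pi * j / m) : ℂ) • xCoord - (Real.cos (Real.pi * j / m) : ℂ) • yCoord

/-- The reflection `s_j` in the root `α_j`. -/
def refl (m j : ℕ) : DihedralGroup m := .sr (j : ZMod m)

theorem stdAddChar_natCast (m : ℕ) [NeZero m] (j : ℕ) :
    (ZMod.stdAddChar (j : ZMod m) : ℂ) =
      Complex.exp ((2 * (Real.pi * j / m) : ℝ) * Complex.I) := by
  have h := ZMod.stdAddChar_coe (N := m) (j : ℤ)
  rw [Int.cast_natCast] at h
  rw [h]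
  congr 1
  push_cast
  ring

/-- `s_j` acts on `E` as the orthogonal reflection in the root `α_j`. -/
theorem act_refl (m : ℕ) [NeZero m] (j : ℕ) (v : EC) :
    act m (refl m j) v = v - (2 * coroot m j v) • root m j := by
  have hs := Real.sin_sq_add_cos_sq (Real.pi * j / m)
  have hs' : (Real.sin (Real.pi * j / m) : ℂ) ^ 2 + (Real.cos (Real.pi * j / m) : ℂ) ^ 2 = 1 := by
    exact_mod_cast hs
  have h1 : (ZMod.stdAddChar (j : ZMod m) : ℂ).re
      = 2 * Real.cos (Real.pi * j / m) ^ 2 - 1 := by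
    rw [stdAddChar_natCast, Complex.exp_ofReal_mul_I_re, Real.cos_two_mul]
  have h2 : (ZMod.stdAddChar (j : ZMod m) : ℂ).im
      = 2 * Real.sin (Real.pi * j / m) * Real.cos (Real.pi * j / m) := by
    rw [stdAddChar_natCast, Complex.exp_ofReal_mul_I_im, Real.sin_two_mul]
  ext i
  fin_cases i
  · simp [act, refl, dihMatrix, h1, h2, coroot, root, xi, eta, xCoord, yCoord, Matrix.mulVec,
      dotProduct, Fin.sum_univ_two, -Complex.ofReal_sin, -Complex.ofReal_cos]
    linear_combination (2 * v 0) * hs'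
  · simp [act, refl, dihMatrix, h1, h2, coroot, root, xi, eta, xCoord, yCoord, Matrix.mulVec,
      dotProduct, Fin.sum_univ_two, -Complex.ofReal_sin, -Complex.ofReal_cos]
    ring

theorem act_one (m : ℕ) [NeZero m] : act m 1 = LinearMap.id := by
  have : (dihMatrix m 1).map (fun t : ℝ => (t : ℂ)) = 1 := by
    rw [DihedralGroup.one_def]
    ext i j
    fin_cases i <;> fin_cases j <;> simp [dihMatrix]
  rw [act, this, Matrix.toLin'_one]

theorem act_mul (m : ℕ) [NeZero m] (g h : DihedralGroup m) :
    act m (g * h) = act m g ∘ₗ act m h := by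
  have key : dihMatrix m (g * h) = dihMatrix m g * dihMatrix m h := by
    have hn : ∀ a : ZMod m, (ZMod.stdAddChar a : ℂ).re ^ 2 + (ZMod.stdAddChar a : ℂ).im ^ 2 = 1 := by
      intro a
      have := Circle.normSq_coe (ZMod.toCircle a)
      rw [Complex.normSq_apply] at this
      rw [ZMod.stdAddChar_apply]
      linarith
    have hneg : ∀ a : ZMod m, (ZMod.stdAddChar (-a) : ℂ) = (starRingEnd ℂ) (ZMod.stdAddChar a) := by
      intro a
      rw [ZMod.stdAddChar_apply, ZMod.stdAddChar_apply, AddChar.map_neg_eq_inv, Circle.coe_inv_eq_conj]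
    cases g <;> cases h <;> ext i j <;> fin_cases i <;> fin_cases j <;>
      simp [dihMatrix, sub_eq_add_neg, AddChar.map_add_eq_mul, hneg, Matrix.mul_apply,
        Fin.sum_univ_two] <;> ring
  have hm : (dihMatrix m (g * h)).map (fun t : ℝ => (t : ℂ)) =
      (dihMatrix m g).map (fun t : ℝ => (t : ℂ)) * (dihMatrix m h).map (fun t : ℝ => (t : ℂ)) := by
    rw [key]
    ext i j
    simp [Matrix.mul_apply]
  rw [act, hm, Matrix.toLin'_mul]
  rfl

/-- `c j` is the value `c(s_j)` of the parameter function on the reflections; the parameter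
function has to be constant on conjugacy classes. -/
def IsParameter (m : ℕ) (c : ZMod m → ℂ) : Prop :=
  ∀ (g : DihedralGroup m) (i j : ZMod m), g * .sr i * g⁻¹ = .sr j → c i = c j

/-! ### The rational Cherednik algebra -/

/-- Generators of the rational Cherednik algebra: vectors, covectors and group elements. -/
inductive Gen (m : ℕ) : Type
  | vec (v : EC)
  | covec (x : ECd)
  | grp (g : DihedralGroup m)

local notation "⟪" a "⟫" => FreeAlgebra.ι ℂ a

/-- The relations of the rational Cherednik algebra. The relations down to `grp_covec` present the
semidirect product `T(E_ℂ ⊕ E_ℂ^*) ⋊ ℂ[G]`. -/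
inductive Rel (m : ℕ) [NeZero m] (c : ZMod m → ℂ) :
    FreeAlgebra ℂ (Gen m) → FreeAlgebra ℂ (Gen m) → Prop
  | vec_add (v w : EC) : Rel m c ⟪Gen.vec (v + w)⟫ (⟪Gen.vec v⟫ + ⟪Gen.vec w⟫)
  | vec_smul (t : ℂ) (v : EC) : Rel m c ⟪Gen.vec (t • v)⟫ (t • ⟪Gen.vec v⟫)
  | covec_add (x y : ECd) : Rel m c ⟪Gen.covec (x + y)⟫ (⟪Gen.covec x⟫ + ⟪Gen.covec y⟫)
  | covec_smul (t : ℂ) (x : ECd) : Rel m c ⟪Gen.covec (t • x)⟫ (t • ⟪Gen.covec x⟫)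
  | grp_one : Rel m c ⟪Gen.grp 1⟫ 1
  | grp_mul (g h : DihedralGroup m) :
      Rel m c ⟪Gen.grp (g * h)⟫ (⟪Gen.grp g⟫ * ⟪Gen.grp h⟫)
  | grp_vec (g : DihedralGroup m) (v : EC) :
      Rel m c (⟪Gen.grp g⟫ * ⟪Gen.vec v⟫) (⟪Gen.vec (act m g v)⟫ * ⟪Gen.grp g⟫)
  | grp_covec (g : DihedralGroup m) (x : ECd) :
      Rel m c (⟪Gen.grp g⟫ * ⟪Gen.covec x⟫) (⟪Gen.covec (actDual m g x)⟫ * ⟪Gen.grp g⟫)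
  | vec_comm (v w : EC) :
      Rel m c (⟪Gen.vec v⟫ * ⟪Gen.vec w⟫) (⟪Gen.vec w⟫ * ⟪Gen.vec v⟫)
  | covec_comm (x y : ECd) :
      Rel m c (⟪Gen.covec x⟫ * ⟪Gen.covec y⟫) (⟪Gen.covec y⟫ * ⟪Gen.covec x⟫)
  | cherednik (v : EC) (x : ECd) :
      Rel m c (⟪Gen.vec v⟫ * ⟪Gen.covec x⟫ - ⟪Gen.covec x⟫ * ⟪Gen.vec v⟫)
        (algebraMap ℂ _ (x v) - (2 : ℂ) • ∑ j ∈ Finset.Icc 1 m,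
          (x (root m j) * coroot m j v / coroot m j (root m j) * c (j : ZMod m)) •
            ⟪Gen.grp (refl m j)⟫)

/-- The rational Cherednik algebra `H_c(G, E)` for `G = I₂(m)` acting on `E = ℝ²`. -/
def Cherednik (m : ℕ) [NeZero m] (c : ZMod m → ℂ) : Type := RingQuot (Rel m c)

section Cherednik

variable (m : ℕ) [NeZero m] (c : ZMod m → ℂ)

instance : Ring (Cherednik m c) := inferInstanceAs (Ring (RingQuot (Rel m c)))

instance : Algebra ℂ (Cherednik m c) := inferInstanceAs (Algebra ℂ (RingQuot (Rel m c)))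

/-- The image of a generator in `H_c(G, E)`. -/
def gen (a : Gen m) : Cherednik m c := RingQuot.mkAlgHom ℂ (Rel m c) (FreeAlgebra.ι ℂ a)

/-- The image of `v ∈ E_ℂ` in `H_c(G, E)`. -/
def vec (v : EC) : Cherednik m c := gen m c (.vec v)

/-- The image of `x ∈ E_ℂ^*` in `H_c(G, E)`. -/
def covec (x : ECd) : Cherednik m c := gen m c (.covec x)

/-- The image of `g ∈ G` in `H_c(G, E)`. -/
def grp (g : DihedralGroup m) : Cherednik m c := gen m c (.grp g)

/-- `z = x + i y`. -/
def z : Cherednik m c := covec m c (xCoord + Complex.I • yCoord)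

/-- `z̄ = x - i y`. -/
def zbar : Cherednik m c := covec m c (xCoord - Complex.I • yCoord)

/-- `ζ = (ξ - i η) / 2`. -/
def zeta : Cherednik m c := vec m c ((1 / 2 : ℂ) • (xi - Complex.I • eta))

/-- `ζ̄ = (ξ + i η) / 2`. -/
def zetabar : Cherednik m c := vec m c ((1 / 2 : ℂ) • (xi + Complex.I • eta))

/-- `H = z ζ + z̄ ζ̄ + 1 - ∑ₛ c(s) s`. -/
def elH : Cherednik m c :=
  z m c * zeta m c + zbar m c * zetabar m c + 1
    - ∑ j ∈ Finset.Icc 1 m, c (j : ZMod m) • grp m c (refl m j)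

/-- `Z₀ = z̄ ζ̄ - z ζ`. -/
def elZ0 : Cherednik m c := zbar m c * zetabar m c - z m c * zeta m c

end Cherednik

/-! ### The Clifford algebra and the spinor space -/

/-- The `ℂ`-bilinear extension `B_ℂ` of the Euclidean form. -/
def BC : LinearMap.BilinForm ℂ EC := Matrix.toBilin' 1

/-- The complex Clifford algebra, in which `v w + w v = 2 B_ℂ(v, w)`. -/
abbrev Cl : Type := CliffordAlgebra BC.toQuadraticMap

/-- The complexified complex structure: `J ξ = - η`, `J η = ξ`. -/
def J : EC →ₗ[ℂ] EC := Matrix.toLin' !![0, 1; -1, 0]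

/-- `π⁺ = (1 + i J) / 2`. -/
def piPlus : EC →ₗ[ℂ] EC := (1 / 2 : ℂ) • (LinearMap.id + Complex.I • J)

/-- `π⁻ = (1 - i J) / 2`. -/
def piMinus : EC →ₗ[ℂ] EC := (1 / 2 : ℂ) • (LinearMap.id - Complex.I • J)

/-- The inverse of the isomorphism `E_ℂ → E_ℂ^*`, `v ↦ B_ℂ(·, v)`. -/
def top (a : ECd) : EC := fun i => a (Pi.single i 1)

/-- `e₁`, the Clifford generator of `ξ`. -/
def e1 : Cl := CliffordAlgebra.ι _ xi

/-- `e₂`, the Clifford generator of `η`. -/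
def e2 : Cl := CliffordAlgebra.ι _ eta

/-- `f = (e₁ - i e₂) / 2`. -/
def f : Cl := (1 / 2 : ℂ) • (e1 - Complex.I • e2)

/-- `f† = (e₁ + i e₂) / 2`. -/
def fd : Cl := (1 / 2 : ℂ) • (e1 + Complex.I • e2)

/-- The spinor space `𝕊 = (⋀ f†) I` with `I = f f†`, as the left ideal of the Clifford algebra
generated by `I` (since `f I = 0`, this left ideal is `(⋀ f†) I`). -/
def Spinor : Type := (Submodule.span Cl {f * fd} : Submodule Cl Cl)

instance : AddCommGroup Spinor :=
  inferInstanceAs (AddCommGroup (Submodule.span Cl {f * fd} : Submodule Cl Cl))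

instance : Module Cl Spinor :=
  inferInstanceAs (Module Cl (Submodule.span Cl {f * fd} : Submodule Cl Cl))

instance : Module ℂ Spinor :=
  inferInstanceAs (Module ℂ (Submodule.span Cl {f * fd} : Submodule Cl Cl))

instance : IsScalarTower ℂ Cl Spinor :=
  inferInstanceAs (IsScalarTower ℂ Cl (Submodule.span Cl {f * fd} : Submodule Cl Cl))

/-- The element `I = f f†` of the spinor space. -/
def spinI : Spinor :=
  (⟨f * fd, Submodule.subset_span rfl⟩ : (Submodule.span Cl {f * fd} : Submodule Cl Cl))

/-- The space `𝕊ˡ` of spinors of degree `l`, spanned by `(f†)ˡ I`. -/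
def spinorDeg (l : ℕ) : Submodule ℂ Spinor := Submodule.span ℂ {fd ^ l • spinI}

/-! ### The elements of `H_c(G, E) ⊗ 𝒞` -/

section Elements

variable (m : ℕ) [NeZero m] (c : ZMod m → ℂ)

/-- `F₋ = 2 ζ ⊗ f†`. -/
def Fminus : Cherednik m c ⊗[ℂ] Cl := (2 : ℂ) • (zeta m c ⊗ₜ[ℂ] fd)

/-- `F̄₋ = 2 ζ̄ ⊗ f`. -/
def Fbarminus : Cherednik m c ⊗[ℂ] Cl := (2 : ℂ) • (zetabar m c ⊗ₜ[ℂ] f)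

/-- `τ_s = 1 - (2 / ⟨a_s, α_s⟩) π⁻(α_s) π⁺(a_s^⊤)` for the reflection `s = s_j`. -/
def tauRefl (j : ℕ) : Cl :=
  1 - (2 / coroot m j (root m j)) •
    (CliffordAlgebra.ι _ (piMinus (root m j)) * CliffordAlgebra.ι _ (piPlus (top (coroot m j))))

/-- `Ω_c = ∑ₛ c(s) s ⊗ τ_s`. -/
def Omega : Cherednik m c ⊗[ℂ] Cl :=
  ∑ j ∈ Finset.Icc 1 m, c (j : ZMod m) • (grp m c (refl m j) ⊗ₜ[ℂ] tauRefl m j)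

/-- `H ⊗ 1`. -/
def opH : Cherednik m c ⊗[ℂ] Cl := elH m c ⊗ₜ[ℂ] 1

/-- `Z₁ = Z₀ - Ω_c`. -/
def opZ1 : Cherednik m c ⊗[ℂ] Cl := elZ0 m c ⊗ₜ[ℂ] 1 - Omega m c

/-- `Z₂ = [f†, f] / 2`. -/
def opZ2 : Cherednik m c ⊗[ℂ] Cl := 1 ⊗ₜ[ℂ] ((1 / 2 : ℂ) • (fd * f - f * fd))

/-- `Z = 2 Z₂ - Z₁`. -/
def opZ : Cherednik m c ⊗[ℂ] Cl := (2 : ℂ) • opZ2 m c - opZ1 m c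

end Elements

/-! ### Standard modules and the joint kernels -/

section Modules

variable {m : ℕ} [NeZero m] (c : ZMod m → ℂ) {V : Type*} [AddCommGroup V] [Module ℂ V]
  (τ : Representation ℂ (DihedralGroup m) V)

/-- The operator by which `σ = ∑ₛ c(s) s ∈ ℂ[G]` acts on `V(τ)`. -/
def sigmaOn : V →ₗ[ℂ] V := ∑ j ∈ Finset.Icc 1 m, c (j : ZMod m) • τ (refl m j)

/-- The `H_c`-submodule of `H_c ⊗_ℂ V(τ)` generated by the relations `h g ⊗ v = h ⊗ τ(g) v` for
`g ∈ G` and `h ξ ⊗ v = 0` for `ξ ∈ E_ℂ`. -/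
def inducedRel : Submodule (Cherednik m c) (Cherednik m c ⊗[ℂ] V) :=
  Submodule.span _
    ({t | ∃ (h : Cherednik m c) (g : DihedralGroup m) (v : V),
        t = (h * grp m c g) ⊗ₜ[ℂ] v - h ⊗ₜ[ℂ] τ g v} ∪
     {t | ∃ (h : Cherednik m c) (w : EC) (v : V), t = (h * vec m c w) ⊗ₜ[ℂ] v})

/-- The standard module `M_c(τ)`: the `H_c`-module induced from `V(τ)`, on which `G` acts through
`τ` and `E` by zero. -/
def StdModule : Type _ := (Cherednik m c ⊗[ℂ] V) ⧸ inducedRel c τ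

instance : AddCommGroup (StdModule c τ) :=
  inferInstanceAs (AddCommGroup ((Cherednik m c ⊗[ℂ] V) ⧸ inducedRel c τ))

instance : Module (Cherednik m c) (StdModule c τ) :=
  inferInstanceAs (Module (Cherednik m c) ((Cherednik m c ⊗[ℂ] V) ⧸ inducedRel c τ))

instance : Module ℂ (StdModule c τ) :=
  inferInstanceAs (Module ℂ ((Cherednik m c ⊗[ℂ] V) ⧸ inducedRel c τ))

instance : IsScalarTower ℂ (Cherednik m c) (StdModule c τ) :=
  inferInstanceAs (IsScalarTower ℂ (Cherednik m c) ((Cherednik m c ⊗[ℂ] V) ⧸ inducedRel c τ))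

/-- The quotient map `H_c ⊗_ℂ V(τ) → M_c(τ)`. -/
def stdMk : Cherednik m c ⊗[ℂ] V →ₗ[Cherednik m c] StdModule c τ := (inducedRel c τ).mkQ

/-- The degree `k` part `M_c(τ)_k = ℂ_k ⊗ V(τ)`, spanned by the `x₁ ⋯ x_k ⊗ v` with
`x₁, …, x_k ∈ E_ℂ^*` and `v ∈ V(τ)`. -/
def stdDeg (k : ℕ) : Submodule ℂ (StdModule c τ) :=
  Submodule.span ℂ {t | ∃ (x : Fin k → ECd) (v : V),
    t = stdMk c τ ((List.ofFn fun i => covec m c (x i)).prod ⊗ₜ[ℂ] v)}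

/-- `K_c(τ) = M_c(τ) ⊗ 𝕊`. -/
abbrev SpinModule : Type _ := StdModule c τ ⊗[ℂ] Spinor

/-- The action of `H_c(G, E) ⊗ 𝒞` on `K_c(τ)`, given by `(h ⊗ a) (p ⊗ s) = h p ⊗ a s`. -/
def action : (Cherednik m c ⊗[ℂ] Cl) →ₐ[ℂ] Module.End ℂ (SpinModule c τ) :=
  (Module.endTensorEndAlgHom (R := ℂ) (S := ℂ) (A := ℂ) (M := StdModule c τ) (N := Spinor)).comp
    (Algebra.TensorProduct.map
      (Algebra.lsmul ℂ ℂ (StdModule c τ)) (Algebra.lsmul ℂ ℂ Spinor))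

/-- The subspace `M_c(τ)_k ⊗ 𝕊ˡ` of `K_c(τ)`. -/
def bidegree (k l : ℕ) : Submodule ℂ (SpinModule c τ) :=
  LinearMap.range (TensorProduct.map (stdDeg c τ k).subtype (spinorDeg l).subtype)

/-- `ℳ_c(τ)_kˡ`: the elements of `K_c(τ)` of polynomial degree `k` and spinor degree `l` in the
kernel of both `F₋` and `F̄₋`. -/
def jointKernel (k l : ℕ) : Submodule ℂ (SpinModule c τ) :=
  bidegree c τ k l ⊓ LinearMap.ker (action c τ (Fminus m c)) ⊓
    LinearMap.ker (action c τ (Fbarminus m c))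

end Modules

end DihedralSpinor

end

open DihedralSpinor

namespace DihedralSpinor

/-! ### The central element `σ` acts on an irreducible representation by a scalar -/

/-! The identity behind everything is `Z₁ = (-1)ˡ (H - 1)` on the joint kernel. Since `σ` is central
in `ℂ[G]`, Schur's lemma makes it a scalar `N` on `V(τ)`. `H` is an Euler element: `[H, u] = u` for
covectors `u` (`elH_mul_covec`), and it acts by `1 - N` on `1 ⊗ V(τ)`, hence by `k + 1 - N` in
degree `k`. On the Clifford side, `τ_s = 1 - 2 f†f` does not depend on `s` (`tauRefl_eq`) and `f†f`
acts on `𝕊ˡ` by `l`, so `Ω_c` acts there as `(-1)ˡ σ`. For `l = 0` the equation for `F₋` removes `z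
ζ`, and `H - 1` and `Z₁` both become `z̄ ζ̄ - σ`. For `l = 1` the equation for `F̄₋` removes `z̄
ζ̄`, leaving `H - 1 = z ζ - σ` and `Z₁ = -z ζ + σ`. -/

theorem sum_Icc_natCast {m : ℕ} [NeZero m] {A : Type*} [AddCommMonoid A] (F : ZMod m → A) :
    ∑ j ∈ Finset.Icc 1 m, F (j : ZMod m) = ∑ j : ZMod m, F j := by
  have hm : 0 < m := NeZero.pos m
  refine Finset.sum_bij (fun j _ => (j : ZMod m)) (fun _ _ => Finset.mem_univ _) ?_ ?_
    (fun _ _ => rfl)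
  · intro a ha b hb hab
    rw [Finset.mem_Icc] at ha hb
    rw [ZMod.natCast_eq_natCast_iff, Nat.modEq_iff_dvd] at hab
    obtain ⟨q, hq⟩ := hab
    have h1 : (m : ℤ) * q < m * 1 := by omega
    have h2 : (m : ℤ) * (-1) < m * q := by omega
    have h3 := lt_of_mul_lt_mul_left h1 (by omega)
    have h4 := lt_of_mul_lt_mul_left h2 (by omega)
    obtain rfl : q = 0 := by omega
    omega
  · intro b _
    by_cases hb : b = 0
    -- The index set is `1, …, m`, so the residue `0` is represented by `m`.
    · exact ⟨m, Finset.mem_Icc.2 ⟨hm, le_rfl⟩, by simp [hb]⟩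
    · refine ⟨b.val, Finset.mem_Icc.2 ⟨?_, (ZMod.val_lt b).le⟩, by simp⟩
      rwa [Nat.one_le_iff_ne_zero, Ne, ZMod.val_eq_zero]

/-- Conjugation permutes the reflections: on indices it is `j ↦ j - 2i` for `r i` and `j ↦ 2i - j`
for `sr i`. -/
theorem exists_conj_sr {m : ℕ} (g : DihedralGroup m) :
    ∃ e : ZMod m ≃ ZMod m, ∀ j, g * .sr j = .sr (e j) * g := by
  cases g with
  | r i =>
    refine ⟨Equiv.subRight (i + i), fun j => ?_⟩
    simp only [Equiv.subRight_apply, DihedralGroup.r_mul_sr, DihedralGroup.sr_mul_r]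
    congr 1; ring
  | sr i =>
    refine ⟨(Equiv.subLeft (i + i)), fun j => ?_⟩
    simp only [Equiv.subLeft_apply, DihedralGroup.sr_mul_sr]
    congr 1; ring

section Schur

variable {m : ℕ} [NeZero m] {c : ZMod m → ℂ} {V : Type*} [AddCommGroup V] [Module ℂ V]
  (τ : Representation ℂ (DihedralGroup m) V)

/-- Conjugation by `g` only reindexes the sum `σ`, and `c` is constant on conjugacy classes. -/
theorem sigmaOn_comm (hc : IsParameter m c) (g : DihedralGroup m) (v : V) :
    τ g (sigmaOn c τ v) = sigmaOn c τ (τ g v) := by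
  obtain ⟨e, he⟩ := exists_conj_sr g
  have hs : sigmaOn c τ = ∑ j : ZMod m, c j • τ (.sr j) :=
    sum_Icc_natCast fun j => c j • τ (.sr j)
  rw [hs]
  simp only [LinearMap.sum_apply, LinearMap.smul_apply, map_sum, map_smul]
  conv_rhs => rw [← Equiv.sum_comp e]
  refine Finset.sum_congr rfl fun j _ => ?_
  have h1 : c j = c (e j) := hc g j (e j) (by rw [he, mul_inv_cancel_right])
  rw [h1, ← Module.End.mul_apply, ← map_mul, he, map_mul, Module.End.mul_apply]

/-- The orbit of a nonzero vector is finite and its span is a nonzero subrepresentation, hence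
everything. This supplies the finite dimension used in Schur's lemma over `ℂ`. -/
theorem finiteDimensional_of_isIrreducible {G : Type*} [Group G] [Finite G]
    (ρ : Representation ℂ G V) [ρ.IsIrreducible] : FiniteDimensional ℂ V := by
  by_cases hV : ∃ v : V, v ≠ 0
  · obtain ⟨v, hv⟩ := hV
    let S : Subrepresentation ρ :=
      { toSubmodule := Submodule.span ℂ (Set.range fun g => ρ g v)
        apply_mem_toSubmodule := by
          intro g w hw
          refine Submodule.span_induction ?_ (by simp) ?_ ?_ hw
          · rintro _ ⟨h, rfl⟩
            refine Submodule.subset_span ⟨g * h, ?_⟩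
            simp
          · intro x y _ _ hx hy
            rw [map_add]; exact add_mem hx hy
          · intro t x _ hx
            rw [map_smul]; exact Submodule.smul_mem _ _ hx }
    have hvS : v ∈ S.toSubmodule := Submodule.subset_span ⟨1, by simp⟩
    rcases eq_bot_or_eq_top S with h | h
    · rw [h] at hvS
      exact absurd ((Submodule.mem_bot ℂ).1 hvS) hv
    · have h' : Submodule.span ℂ (Set.range fun g => ρ g v) = ⊤ :=
        congrArg Subrepresentation.toSubmodule h
      exact Module.finite_def.2 (h' ▸ Submodule.fg_span (Set.finite_range _))
  · push Not at hV
    have : Subsingleton V := ⟨fun a b => by rw [hV a, hV b]⟩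
    infer_instance

theorem exists_sigmaOn_eq_smul (hc : IsParameter m c) [τ.IsIrreducible] :
    ∃ N : ℂ, ∀ v : V, sigmaOn c τ v = N • v := by
  have := finiteDimensional_of_isIrreducible τ
  let T : Representation.IntertwiningMap τ τ :=
    { sigmaOn c τ with
      isIntertwining' := fun g => LinearMap.ext fun v => (sigmaOn_comm τ hc g v).symm }
  obtain ⟨N, hN⟩ :=
    (Representation.IsIrreducible.algebraMap_intertwiningMap_bijective_of_isAlgClosed).2 T
  refine ⟨N, fun v => ?_⟩
  have h := congrArg (fun S : Representation.IntertwiningMap τ τ => S v) hN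
  exact h.symm

end Schur


/-! ### Relations in the rational Cherednik algebra and the Euler element -/

section Relations

variable {m : ℕ} [NeZero m] {c : ZMod m → ℂ}

theorem actDual_refl (j : ℕ) (u : ECd) :
    actDual m (refl m j) u = u - (2 * u (root m j)) • coroot m j := by
  refine LinearMap.ext fun v => ?_
  have h : (refl m j)⁻¹ = refl m j := by simp [refl]
  rw [actDual, h, LinearMap.comp_apply, act_refl]
  simp
  ring

omit [NeZero m] in
theorem coroot_root (j : ℕ) : coroot m j (root m j) = 1 := by
  have hs : (Real.sin (Real.pi * j / m) : ℂ) ^ 2 + (Real.cos (Real.pi * j / m) : ℂ) ^ 2 = 1 := by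
    exact_mod_cast Real.sin_sq_add_cos_sq (Real.pi * j / m)
  simp [coroot, root, xi, eta, xCoord, yCoord, -Complex.ofReal_sin, -Complex.ofReal_cos]
  linear_combination hs

theorem quot_rel {a b : FreeAlgebra ℂ (Gen m)} (h : Rel m c a b) :
    (RingQuot.mkAlgHom ℂ (Rel m c) a : RingQuot (Rel m c)) = RingQuot.mkAlgHom ℂ (Rel m c) b :=
  RingQuot.mkAlgHom_rel ℂ h

theorem covec_add (x y : ECd) : covec m c (x + y) = covec m c x + covec m c y :=
  (quot_rel (.covec_add x y)).trans (map_add _ _ _)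

theorem covec_smul (t : ℂ) (x : ECd) : covec m c (t • x) = t • covec m c x :=
  (quot_rel (.covec_smul t x)).trans (map_smul _ _ _)

theorem covec_comm (x y : ECd) : covec m c x * covec m c y = covec m c y * covec m c x :=
  (map_mul _ _ _).symm.trans ((quot_rel (.covec_comm x y)).trans (map_mul _ _ _))

theorem grp_covec (g : DihedralGroup m) (x : ECd) :
    grp m c g * covec m c x = covec m c (actDual m g x) * grp m c g :=
  (map_mul _ _ _).symm.trans ((quot_rel (.grp_covec g x)).trans (map_mul _ _ _))

theorem covec_sub (x y : ECd) : covec m c (x - y) = covec m c x - covec m c y := by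
  rw [eq_sub_iff_add_eq, ← covec_add, sub_add_cancel]

theorem vec_mul_covec (v : EC) (x : ECd) :
    vec m c v * covec m c x = covec m c x * vec m c v + algebraMap ℂ _ (x v) -
      (2 : ℂ) • ∑ j ∈ Finset.Icc 1 m,
        (x (root m j) * coroot m j v * c (j : ZMod m)) • grp m c (refl m j) := by
  have h := quot_rel (Rel.cherednik (m := m) (c := c) v x)
  rw [map_sub, map_mul, map_mul, map_sub, AlgHom.commutes, map_smul, map_sum] at h
  simp only [map_smul, coroot_root, div_one] at h
  rw [add_sub_assoc]
  exact (sub_eq_iff_eq_add'.1 h)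

/-- `z, z̄` is the basis dual to `ζ, ζ̄`. This is used both for `u` itself and for the coroots `a_j`
in the reflection terms. -/
theorem dual_basis (u : ECd) :
    u ((1 / 2 : ℂ) • (xi - Complex.I • eta)) • (xCoord + Complex.I • yCoord) +
      u ((1 / 2 : ℂ) • (xi + Complex.I • eta)) • (xCoord - Complex.I • yCoord) = u := by
  refine LinearMap.pi_ext' fun i => LinearMap.ext_ring ?_
  fin_cases i <;>
  · simp [xi, eta, xCoord, yCoord]
    ring_nf
    try simp

theorem covec_dual_basis (u : ECd) :
    u ((1 / 2 : ℂ) • (xi - Complex.I • eta)) • z m c +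
      u ((1 / 2 : ℂ) • (xi + Complex.I • eta)) • zbar m c = covec m c u := by
  conv_rhs => rw [← dual_basis u]
  rw [covec_add, covec_smul, covec_smul]
  rfl

/-- Commuting `u` past `z ζ + z̄ ζ̄` yields `u - 2 ∑ u(α_j) c_j a_j s_j`. Because `s_j u = (u - 2
u(α_j) a_j) s_j`, the commutator of `-σ` with `u` is exactly the opposite of the reflection sum, and
only `u` survives. -/
theorem elH_mul_covec (u : ECd) :
    elH m c * covec m c u = covec m c u * elH m c + covec m c u := by
  have hσ : (∑ j ∈ Finset.Icc 1 m, c (j : ZMod m) • grp m c (refl m j)) * covec m c u =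
      covec m c u * (∑ j ∈ Finset.Icc 1 m, c (j : ZMod m) • grp m c (refl m j)) -
        (2 : ℂ) • ∑ j ∈ Finset.Icc 1 m,
          (u (root m j) * c (j : ZMod m)) • (covec m c (coroot m j) * grp m c (refl m j)) := by
    rw [Finset.sum_mul, Finset.mul_sum, Finset.smul_sum, ← Finset.sum_sub_distrib]
    refine Finset.sum_congr rfl fun j _ => ?_
    rw [smul_mul_assoc, grp_covec, actDual_refl, covec_sub, covec_smul, sub_mul, smul_mul_assoc,
      mul_smul_comm]
    module
  have hz : ∀ (a : ECd) (v : EC), covec m c a * vec m c v * covec m c u =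
      covec m c u * (covec m c a * vec m c v) + u v • covec m c a -
        (2 : ℂ) • ∑ j ∈ Finset.Icc 1 m,
          (u (root m j) * c (j : ZMod m)) •
            ((coroot m j v • covec m c a) * grp m c (refl m j)) := by
    intro a v
    rw [mul_assoc, vec_mul_covec, mul_sub, mul_add, ← mul_assoc, covec_comm, mul_assoc,
      Algebra.algebraMap_eq_smul_one, mul_smul_comm, mul_smul_comm, mul_one, Finset.mul_sum]
    congr 2
    refine Finset.sum_congr rfl fun j _ => ?_
    rw [mul_smul_comm, smul_mul_assoc, smul_smul]
    congr 1; ring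
  -- Expanding `a_j = a_j(ζ) z + a_j(ζ̄) z̄` matches the sum from `σ` with the two sums from `z ζ`
  -- and `z̄ ζ̄`.
  have hS : ∑ j ∈ Finset.Icc 1 m, (u (root m j) * c (j : ZMod m)) •
        (covec m c (coroot m j) * grp m c (refl m j)) =
      ∑ j ∈ Finset.Icc 1 m, (u (root m j) * c (j : ZMod m)) •
        ((coroot m j ((1 / 2 : ℂ) • (xi - Complex.I • eta)) • z m c) * grp m c (refl m j)) +
      ∑ j ∈ Finset.Icc 1 m, (u (root m j) * c (j : ZMod m)) •
        ((coroot m j ((1 / 2 : ℂ) • (xi + Complex.I • eta)) • zbar m c) * grp m c (refl m j)) := by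
    rw [← Finset.sum_add_distrib]
    refine Finset.sum_congr rfl fun j _ => ?_
    rw [← covec_dual_basis (coroot m j), add_mul, smul_add]
  have h1 : z m c * zeta m c * covec m c u = covec m c u * (z m c * zeta m c) +
      u ((1 / 2 : ℂ) • (xi - Complex.I • eta)) • z m c - (2 : ℂ) • ∑ j ∈ Finset.Icc 1 m,
        (u (root m j) * c (j : ZMod m)) •
          ((coroot m j ((1 / 2 : ℂ) • (xi - Complex.I • eta)) • z m c) * grp m c (refl m j)) :=
    hz _ _
  have h2 : zbar m c * zetabar m c * covec m c u = covec m c u * (zbar m c * zetabar m c) +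
      u ((1 / 2 : ℂ) • (xi + Complex.I • eta)) • zbar m c - (2 : ℂ) • ∑ j ∈ Finset.Icc 1 m,
        (u (root m j) * c (j : ZMod m)) •
          ((coroot m j ((1 / 2 : ℂ) • (xi + Complex.I • eta)) • zbar m c) * grp m c (refl m j)) :=
    hz _ _
  have h3 := (covec_dual_basis (m := m) (c := c) u)
  generalize (1 / 2 : ℂ) • (xi - Complex.I • eta) = v at h1 h2 hS h3
  generalize (1 / 2 : ℂ) • (xi + Complex.I • eta) = w at h1 h2 hS h3
  rw [elH, sub_mul, add_mul, add_mul, h1, h2, hσ, hS, smul_add, one_mul, mul_sub, mul_add, mul_add,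
    mul_one, eq_sub_of_add_eq h3]
  abel

theorem elH_mul_prod (L : List ECd) :
    elH m c * (L.map (covec m c)).prod =
      (L.map (covec m c)).prod * elH m c + (L.length : ℂ) • (L.map (covec m c)).prod := by
  induction L with
  | nil => simp
  | cons u L ih =>
    rw [List.map_cons, List.prod_cons, ← mul_assoc, elH_mul_covec, add_mul, mul_assoc, ih, mul_add,
      mul_smul_comm, ← mul_assoc, List.length_cons]
    push_cast
    module

end Relations

/-! ### Eigenvalues of the Euler element on the standard module -/

section Euler

variable {m : ℕ} [NeZero m] {c : ZMod m → ℂ} {V : Type*} [AddCommGroup V] [Module ℂ V]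
  {τ : Representation ℂ (DihedralGroup m) V}

theorem stdMk_mul_grp (h : Cherednik m c) (g : DihedralGroup m) (v : V) :
    stdMk c τ ((h * grp m c g) ⊗ₜ[ℂ] v) = stdMk c τ (h ⊗ₜ[ℂ] τ g v) :=
  (Submodule.Quotient.eq _).2 (Submodule.subset_span (Or.inl ⟨h, g, v, rfl⟩))

theorem stdMk_mul_vec (h : Cherednik m c) (w : EC) (v : V) :
    stdMk c τ ((h * vec m c w) ⊗ₜ[ℂ] v) = 0 :=
  (Submodule.Quotient.mk_eq_zero _).2 (Submodule.subset_span (Or.inr ⟨h, w, v, rfl⟩))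

/-- Next to `v`, the terms ending in `ζ` or `ζ̄` vanish and `σ` becomes `N`. The left factor `h`
will be the monomial past which `H` has been moved. -/
theorem stdMk_mul_elH {N : ℂ} (hN : ∀ v, sigmaOn c τ v = N • v) (h : Cherednik m c) (v : V) :
    stdMk c τ ((h * elH m c) ⊗ₜ[ℂ] v) = (1 - N) • stdMk c τ (h ⊗ₜ[ℂ] v) := by
  have hσ : stdMk c τ ((h * ∑ j ∈ Finset.Icc 1 m, c (j : ZMod m) • grp m c (refl m j)) ⊗ₜ[ℂ] v) =
      stdMk c τ (h ⊗ₜ[ℂ] (sigmaOn c τ v)) := by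
    rw [Finset.mul_sum, TensorProduct.sum_tmul, map_sum, sigmaOn, LinearMap.sum_apply,
      TensorProduct.tmul_sum, map_sum]
    refine Finset.sum_congr rfl fun j _ => ?_
    rw [mul_smul_comm, LinearMap.smul_apply, TensorProduct.tmul_smul, ← TensorProduct.smul_tmul',
      LinearMap.map_smul_of_tower, LinearMap.map_smul_of_tower, stdMk_mul_grp]
  rw [elH, mul_sub, mul_add, mul_add, mul_one, ← mul_assoc, ← mul_assoc, TensorProduct.sub_tmul,
    TensorProduct.add_tmul, TensorProduct.add_tmul, map_sub, map_add, map_add, hσ, hN, zeta,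
    zetabar, stdMk_mul_vec, stdMk_mul_vec, TensorProduct.tmul_smul,
    LinearMap.map_smul_of_tower]
  module

theorem elH_smul_of_mem_stdDeg {N : ℂ} (hN : ∀ v, sigmaOn c τ v = N • v) {k : ℕ}
    {p : StdModule c τ} (hp : p ∈ stdDeg c τ k) : elH m c • p = ((k : ℂ) + 1 - N) • p := by
  refine Submodule.span_induction ?_ (by simp) ?_ ?_ hp
  · rintro _ ⟨x, v, rfl⟩
    have hL : (List.ofFn fun i => covec m c (x i)) = (List.ofFn x).map (covec m c) := by
      rw [List.map_ofFn]; rfl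
    rw [hL, ← map_smul, TensorProduct.smul_tmul', smul_eq_mul, elH_mul_prod,
      TensorProduct.add_tmul, map_add, stdMk_mul_elH hN, ← TensorProduct.smul_tmul',
      LinearMap.map_smul_of_tower, List.length_ofFn]
    module
  · intro p q _ _ hp hq
    rw [smul_add, smul_add, hp, hq]
  -- `H` is `ℂ`-linear on the module because the image of `ℂ` is central in `H_c`.
  · intro t p _ hp
    rw [smul_comm ((k : ℂ) + 1 - N) t, ← hp, ← algebraMap_smul (Cherednik m c) t p,
      ← algebraMap_smul (Cherednik m c) t (elH m c • p), smul_smul, smul_smul, Algebra.commutes]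

end Euler


/-! ### The Clifford generators `f` and `f†` and their action on spinors -/

theorem BC_apply (v w : EC) : BC v w = v 0 * w 0 + v 1 * w 1 := by
  simp [BC, Matrix.toBilin'_apply', dotProduct, Fin.sum_univ_two]

theorem e1_mul_e1 : e1 * e1 = 1 := by
  rw [e1, CliffordAlgebra.ι_sq_scalar]
  simp [BC_apply, xi]

theorem e2_mul_e2 : e2 * e2 = 1 := by
  rw [e2, CliffordAlgebra.ι_sq_scalar]
  simp [BC_apply, eta]

theorem e2_mul_e1 : e2 * e1 = -(e1 * e2) := by
  rw [e1, e2, eq_neg_iff_add_eq_zero, CliffordAlgebra.ι_mul_ι_add_swap]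
  simp [QuadraticMap.polar, BC_apply, eta, xi]

theorem f_mul_f : f * f = 0 := by
  simp only [f, smul_mul_assoc, mul_smul_comm, sub_mul, mul_sub, e1_mul_e1, e2_mul_e2, e2_mul_e1,
    smul_sub, smul_neg, smul_smul]
  match_scalars <;> ring_nf <;> simp

theorem f_mul_fd_add : f * fd + fd * f = 1 := by
  simp only [f, fd, smul_mul_assoc, mul_smul_comm, add_mul, mul_add, sub_mul, mul_sub, e1_mul_e1,
    e2_mul_e2, e2_mul_e1, smul_add, smul_sub, smul_neg, smul_smul]
  match_scalars <;> ring_nf <;> simp <;> norm_num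

theorem f_smul_spinI : f • spinI = 0 := by
  refine Subtype.ext ?_
  change f * (f * fd) = 0
  rw [← mul_assoc, f_mul_f, zero_mul]

/-- On the line through `I`, `f` inverts `f†`; this is what later lets the Clifford factor of `F₋`
or `F̄₋` be stripped off. -/
theorem f_smul_fd_smul_spinI : f • fd • spinI = spinI := by
  rw [smul_smul, eq_sub_of_add_eq f_mul_fd_add, sub_smul, mul_smul, f_smul_spinI, smul_zero,
    sub_zero, one_smul]

theorem ι_piPlus_coroot (m j : ℕ) :
    (CliffordAlgebra.ι BC.toQuadraticMap (piPlus (top (coroot m j))) : Cl) =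
      ((Real.sin (Real.pi * j / m) : ℂ) - Complex.I * (Real.cos (Real.pi * j / m) : ℂ)) • f := by
  have h : piPlus (top (coroot m j)) =
      ((Real.sin (Real.pi * j / m) : ℂ) - Complex.I * (Real.cos (Real.pi * j / m) : ℂ)) •
        ((1 / 2 : ℂ) • (xi - Complex.I • eta)) := by
    unfold coroot
    generalize (Real.sin (Real.pi * j / m) : ℂ) = s
    generalize (Real.cos (Real.pi * j / m) : ℂ) = t
    ext i
    fin_cases i <;>
    · simp [piPlus, top, J, xi, eta, xCoord, yCoord, dotProduct, Fin.sum_univ_two]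
      ring_nf
      try simp
      try ring
  rw [h, map_smul, map_smul, map_sub, map_smul]
  rfl

theorem ι_piMinus_root (m j : ℕ) :
    (CliffordAlgebra.ι BC.toQuadraticMap (piMinus (root m j)) : Cl) =
      ((Real.sin (Real.pi * j / m) : ℂ) + Complex.I * (Real.cos (Real.pi * j / m) : ℂ)) • fd := by
  have h : piMinus (root m j) =
      ((Real.sin (Real.pi * j / m) : ℂ) + Complex.I * (Real.cos (Real.pi * j / m) : ℂ)) •
        ((1 / 2 : ℂ) • (xi + Complex.I • eta)) := by
    unfold root
    generalize (Real.sin (Real.pi * j / m) : ℂ) = s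
    generalize (Real.cos (Real.pi * j / m) : ℂ) = t
    ext i
    fin_cases i <;>
    · simp [piMinus, Matrix.vecHead, Matrix.vecTail, J, xi, eta,
        dotProduct, Fin.sum_univ_two]
      ring_nf
      try simp
      try ring
  rw [h, map_smul, map_smul, map_add, map_smul]
  rfl

/-- The projections of the root and coroot are multiples of `f†` and `f` by the conjugate unit
phases `sin + i cos` and `sin - i cos`; their product is `1`, so the dependence on `j` disappears.
-/
theorem tauRefl_eq (m j : ℕ) [NeZero m] : tauRefl m j = 1 - (2 : ℂ) • (fd * f) := by
  have hs : (Real.sin (Real.pi * j / m) : ℂ) ^ 2 + (Real.cos (Real.pi * j / m) : ℂ) ^ 2 = 1 := by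
    exact_mod_cast Real.sin_sq_add_cos_sq (Real.pi * j / m)
  rw [tauRefl, coroot_root, div_one, ι_piPlus_coroot, ι_piMinus_root, smul_mul_assoc,
    mul_smul_comm]
  have h1 : ((Real.sin (Real.pi * j / m) : ℂ) + Complex.I * (Real.cos (Real.pi * j / m) : ℂ)) *
      ((Real.sin (Real.pi * j / m) : ℂ) - Complex.I * (Real.cos (Real.pi * j / m) : ℂ)) = 1 := by
    linear_combination hs - (Real.cos (Real.pi * j / m) : ℂ) ^ 2 * Complex.I_mul_I
  rw [smul_smul (_ + _), h1, one_smul]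

theorem fd_mul_f_smul_spinor {l : ℕ} (hl : l ≤ 1) :
    (fd * f) • (fd ^ l • spinI) = (l : ℂ) • (fd ^ l • spinI) := by
  rw [mul_smul]
  interval_cases l
  · simp [f_smul_spinI]
  · simp [f_smul_fd_smul_spinI]

theorem f_mul_fd_smul_spinor {l : ℕ} (hl : l ≤ 1) :
    (f * fd) • (fd ^ l • spinI) = (1 - l : ℂ) • (fd ^ l • spinI) := by
  rw [eq_sub_of_add_eq f_mul_fd_add, sub_smul, one_smul, fd_mul_f_smul_spinor hl, sub_smul,
    one_smul]

/-! ### The weights on the joint kernels -/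

section Weights

variable {m : ℕ} [NeZero m] {c : ZMod m → ℂ} {V : Type*} [AddCommGroup V] [Module ℂ V]
  {τ : Representation ℂ (DihedralGroup m) V}

theorem action_tmul (h : Cherednik m c) (a : Cl) (p : StdModule c τ) (s : Spinor) :
    action c τ (h ⊗ₜ[ℂ] a) (p ⊗ₜ[ℂ] s) = (h • p) ⊗ₜ[ℂ] (a • s) := rfl

/-- `𝕊ˡ` is spanned by one vector, so every tensor in this bidegree is pure. -/
theorem exists_tmul_of_mem_bidegree {k l : ℕ} {M : SpinModule c τ} (hM : M ∈ bidegree c τ k l) :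
    ∃ p ∈ stdDeg c τ k, M = p ⊗ₜ[ℂ] (fd ^ l • spinI) := by
  obtain ⟨t, rfl⟩ := hM
  induction t with
  | zero => exact ⟨0, zero_mem _, by simp⟩
  | tmul p s =>
    obtain ⟨r, hr⟩ := Submodule.mem_span_singleton.1 s.2
    refine ⟨r • (p : StdModule c τ), Submodule.smul_mem _ _ p.2, ?_⟩
    rw [TensorProduct.map_tmul, Submodule.subtype_apply, Submodule.subtype_apply, ← hr,
      TensorProduct.smul_tmul]
  | add a b ha hb =>
    obtain ⟨p, hp, hp'⟩ := ha
    obtain ⟨q, hq, hq'⟩ := hb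
    exact ⟨p + q, add_mem hp hq, by rw [map_add, hp', hq', TensorProduct.add_tmul]⟩

theorem action_Omega_tmul {l : ℕ} (hl : l ≤ 1) (p : StdModule c τ) :
    action c τ (Omega m c) (p ⊗ₜ[ℂ] (fd ^ l • spinI)) =
      (1 - 2 * l : ℂ) • (((∑ j ∈ Finset.Icc 1 m, c (j : ZMod m) • grp m c (refl m j)) • p) ⊗ₜ[ℂ]
        (fd ^ l • spinI)) := by
  have hτ (j : ℕ) : tauRefl m j • (fd ^ l • spinI) = (1 - 2 * l : ℂ) • (fd ^ l • spinI) := by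
    rw [tauRefl_eq, sub_smul, one_smul, smul_assoc, fd_mul_f_smul_spinor hl, smul_smul, sub_smul,
      one_smul]
  generalize (fd ^ l • spinI) = s at hτ ⊢
  rw [Omega, map_sum, LinearMap.sum_apply, Finset.sum_smul, TensorProduct.sum_tmul,
    Finset.smul_sum]
  refine Finset.sum_congr rfl fun j _ => ?_
  rw [map_smul, LinearMap.smul_apply, action_tmul, hτ, TensorProduct.tmul_smul, smul_assoc,
    smul_comm]
  rfl

theorem action_opZ2_tmul {l : ℕ} (hl : l ≤ 1) (p : StdModule c τ) :
    action c τ (opZ2 m c) (p ⊗ₜ[ℂ] (fd ^ l • spinI)) =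
      ((-1 : ℂ) ^ (l + 1) * (1 / 2)) • (p ⊗ₜ[ℂ] (fd ^ l • spinI)) := by
  rw [opZ2, action_tmul, one_smul, smul_assoc, sub_smul, fd_mul_f_smul_spinor hl,
    f_mul_fd_smul_spinor hl, ← sub_smul, smul_smul, TensorProduct.tmul_smul]
  congr 1
  interval_cases l <;> norm_num

theorem action_opH_of_mem_bidegree {N : ℂ} (hN : ∀ v, sigmaOn c τ v = N • v) {k l : ℕ}
    {M : SpinModule c τ} (hM : M ∈ bidegree c τ k l) :
    action c τ (opH m c) M = ((k : ℂ) + 1 - N) • M := by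
  obtain ⟨p, hp, rfl⟩ := exists_tmul_of_mem_bidegree hM
  rw [opH, action_tmul, one_smul, elH_smul_of_mem_stdDeg hN hp, TensorProduct.smul_tmul']

theorem action_opZ1_of_mem_jointKernel {N : ℂ} (hN : ∀ v, sigmaOn c τ v = N • v) {k l : ℕ}
    (hl : l ≤ 1) {M : SpinModule c τ} (hM : M ∈ jointKernel c τ k l) :
    action c τ (opZ1 m c) M = ((-1 : ℂ) ^ l * ((k : ℂ) - N)) • M := by
  obtain ⟨⟨hb, hF⟩, hF'⟩ := hM
  rw [SetLike.mem_coe, LinearMap.mem_ker] at hF hF'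
  have hH := action_opH_of_mem_bidegree hN hb
  obtain ⟨p, hp, rfl⟩ := exists_tmul_of_mem_bidegree hb
  rw [Fminus, map_smul, LinearMap.smul_apply, smul_eq_zero_iff_right two_ne_zero] at hF
  rw [Fbarminus, map_smul, LinearMap.smul_apply, smul_eq_zero_iff_right two_ne_zero] at hF'
  rw [opH, elH, action_tmul, one_smul, sub_smul, add_smul, add_smul, one_smul,
    TensorProduct.sub_tmul, TensorProduct.add_tmul, TensorProduct.add_tmul] at hH
  rw [opZ1, map_sub, LinearMap.sub_apply, action_Omega_tmul hl, action_tmul, elZ0, one_smul,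
    sub_smul, TensorProduct.sub_tmul]
  interval_cases l
  · have h : ((z m c * zeta m c) • p) ⊗ₜ[ℂ] (fd ^ 0 • spinI) = 0 := by
      -- Applying `z ⊗ f` to `ζ p ⊗ f† I = 0` gives `z ζ p ⊗ I = 0`, since `f f† I = I`.
      have := congrArg (action c τ (z m c ⊗ₜ[ℂ] f)) hF
      rwa [map_zero, action_tmul, action_tmul, smul_smul, pow_zero, one_smul,
        f_smul_fd_smul_spinI, ← one_smul Cl spinI, ← pow_zero fd] at this
    rw [h] at hH ⊢
    -- The known value of `H` is solved for the surviving term `z̄ ζ̄ p`; after substitution into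
    -- `Z₁` the `σ` terms cancel.
    rw [zero_add, sub_eq_iff_eq_add, ← eq_sub_iff_add_eq] at hH
    rw [hH]
    push_cast
    module
  · have h : ((zbar m c * zetabar m c) • p) ⊗ₜ[ℂ] (fd ^ 1 • spinI) = 0 := by
      -- The mirror case: `f† f f† I = f† I` turns the equation for `F̄₋` into `z̄ ζ̄ p ⊗ f† I = 0`.
      have := congrArg (action c τ (zbar m c ⊗ₜ[ℂ] fd)) hF'
      rwa [map_zero, action_tmul, action_tmul, smul_smul, pow_one,
        f_smul_fd_smul_spinI, ← pow_one fd] at this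
    rw [h] at hH ⊢
    rw [add_zero, sub_eq_iff_eq_add, ← eq_sub_iff_add_eq] at hH
    rw [hH]
    push_cast
    module

theorem weights_of_mem_jointKernel {N : ℂ} (hN : ∀ v, sigmaOn c τ v = N • v) {k l : ℕ}
    (hl : l ≤ 1) {M : SpinModule c τ} (hM : M ∈ jointKernel c τ k l) :
    action c τ (opH m c) M = ((k : ℂ) + 1 - N) • M ∧
      action c τ (opZ2 m c) M = ((-1 : ℂ) ^ (l + 1) * (1 / 2)) • M ∧
      action c τ (opZ1 m c) M = ((-1 : ℂ) ^ l * ((k : ℂ) - N)) • M ∧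
      action c τ (opZ m c) M = ((-1 : ℂ) ^ (l + 1) * ((k : ℂ) + 1 - N)) • M := by
  have h2 : action c τ (opZ2 m c) M = ((-1 : ℂ) ^ (l + 1) * (1 / 2)) • M := by
    obtain ⟨p, -, rfl⟩ := exists_tmul_of_mem_bidegree hM.1.1
    exact action_opZ2_tmul hl p
  have h1 := action_opZ1_of_mem_jointKernel hN hl hM
  refine ⟨action_opH_of_mem_bidegree hN hM.1.1, h2, h1, ?_⟩
  rw [opZ, map_sub, map_smul, LinearMap.sub_apply, LinearMap.smul_apply, h1, h2, smul_smul,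
    ← sub_smul]
  congr 1
  ring

end Weights

end DihedralSpinor

theorem mainTheorem8 (m : ℕ) [NeZero m] (c : ZMod m → ℂ) (hc : IsParameter m c)
    {V : Type*} [AddCommGroup V] [Module ℂ V]
    (τ : Representation ℂ (DihedralGroup m) V) [τ.IsIrreducible] :
    ∃ N : ℂ, (∀ v : V, sigmaOn c τ v = N • v) ∧
      (∀ (k l : ℕ), l ≤ 1 → ∀ M ∈ jointKernel c τ k l,
        action c τ (opH m c) M = ((k : ℂ) + 1 - N) • M ∧
        action c τ (opZ2 m c) M = ((-1 : ℂ) ^ (l + 1) * (1 / 2)) • M ∧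
        action c τ (opZ1 m c) M = ((-1 : ℂ) ^ l * ((k : ℂ) - N)) • M ∧
        action c τ (opZ m c) M = ((-1 : ℂ) ^ (l + 1) * ((k : ℂ) + 1 - N)) • M) ∧
      (∀ (k l : ℕ), l ≤ 1 → ∀ M ∈ jointKernel c τ k l, M ≠ 0 →
        ∀ lam gam nu : ℂ, action c τ (opH m c) M = lam • M →
          action c τ (opZ2 m c) M = gam • M → action c τ (opZ1 m c) M = nu • M →
            nu = -2 * gam * (lam - 1)) := by
  obtain ⟨N, hN⟩ := exists_sigmaOn_eq_smul τ hc
  refine ⟨N, hN, fun k l hl M hM => weights_of_mem_jointKernel hN hl hM, ?_⟩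
  intro k l hl M hM hM0 lam gam nu hH h2 h1
  obtain ⟨hH', h2', h1', -⟩ := weights_of_mem_jointKernel hN hl hM
  -- As `M ≠ 0`, each weight equals the computed one, and `-2γ = (-1)ˡ`, `λ - 1 = k - N`.
  rw [hH', smul_left_inj hM0] at hH
  rw [h2', smul_left_inj hM0] at h2
  rw [h1', smul_left_inj hM0] at h1
  rw [← hH, ← h2, ← h1]
  ring
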